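/- Let $G$ be a finite simple graph, not necessarily connected, embedded in the plane, with vertex degrees $d(v)$ and maximum degree $\Delta(G)=6$. The degree of a face is the number of edges along its boundary, cut-edges being counted twice; a $4$-face $uvwx$ is a face of degree $4$ whose boundary edges form the $4$-cycle $uvwx$ (isolated vertices of $G$ may lie in the face). A triangle is a $3$-cycle of $G$, and it is of type $(a,b,c)$ if its vertices have degrees $a$, $b$, $c$ in some order. Suppose that $G$ contains no kite, that is, no two distinct triangles of $G$ share an edge. Then at least one of the following holds. (i) $G$ has an edge $uv$ with $d(u)+d(v)\le 8$. (ii) $G$ has a $4$-face $uvwx$ with $d(u)=d(w)=3$. (iii) $G$ has a vertex of degree $6$ that lies on three distinct triangles, two of which are of type $(6,6,3)$, while the third is of type $(6,6,3)$, $(6,5,4)$ or $(6,6,4)$. -/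

import Mathlib

universe u w

namespace SimpleGraph

variable {V : Type u}

/-- No kite: there are no two distinct 3-cycles `a b c` and `a b d` sharing an edge `ab`. -/
def HasNoKite (G : SimpleGraph V) : Prop :=
  ∀ a b c d : V, G.Adj a b → G.Adj a c → G.Adj b c → G.Adj a d → G.Adj b d → c = d

/-- A rotation system: a permutation of the darts (directed edges) whose cycles are exactly the
sets of darts leaving a common vertex. It lists the edges at every vertex in cyclic order. -/
structure RotationSystem (G : SimpleGraph V) where
  next : Equiv.Perm G.Dart
  sameCycle_iff : ∀ d e : G.Dart, next.SameCycle d e ↔ d.fst = e.fst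

namespace RotationSystem

variable {G : SimpleGraph V}

/-- Face tracing: after running along the dart from `u` to `v`, continue with the dart that follows
the reversed dart (from `v` to `u`) in the rotation at `v`. -/
def facePerm (R : RotationSystem G) : Equiv.Perm G.Dart :=
  (Function.Involutive.toPerm Dart.symm Dart.symm_involutive).trans R.next

/-- The closed facial walks of a rotation system: the cycles of face tracing. -/
def FacialWalk (R : RotationSystem G) : Type u :=
  Quotient (Equiv.Perm.SameCycle.setoid R.facePerm)

theorem next_fst (R : RotationSystem G) (d : G.Dart) : (R.next d).fst = d.fst :=
  ((R.sameCycle_iff d (R.next d)).1 ⟨1, by simp⟩).symm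

theorem facePerm_fst (R : RotationSystem G) (d : G.Dart) : (R.facePerm d).fst = d.snd :=
  R.next_fst d.symm

theorem component_facePerm (R : RotationSystem G) (d : G.Dart) :
    G.connectedComponentMk (R.facePerm d).fst = G.connectedComponentMk d.fst := by
  rw [R.facePerm_fst]
  exact ConnectedComponent.sound d.adj.symm.reachable

theorem component_sameCycle (R : RotationSystem G) {d e : G.Dart}
    (h : R.facePerm.SameCycle d e) :
    G.connectedComponentMk d.fst = G.connectedComponentMk e.fst := by
  obtain ⟨i, rfl⟩ := h
  induction i using Int.induction_on with
  | zero => simp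
  | succ i ih =>
    rw [add_comm, zpow_add, zpow_one, Equiv.Perm.mul_apply, R.component_facePerm]
    exact ih
  | pred i ih =>
    rw [ih, ← R.component_facePerm ((R.facePerm ^ (-(i : ℤ) - 1)) d), ← Equiv.Perm.mul_apply,
      ← zpow_one_add]
    congr 4
    ring_nf

/-- The connected pieces of the boundaries of the faces: the facial walks, and for every isolated
vertex the trivial walk that stays there. -/
abbrev BoundaryPiece (R : RotationSystem G) : Type u :=
  R.FacialWalk ⊕ {v : V // ∀ x, ¬ G.Adj v x}

/-- The connected component of `G` on which a boundary piece lies. -/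
def component (R : RotationSystem G) : R.BoundaryPiece → G.ConnectedComponent
  | Sum.inl q => Quotient.lift (fun d : G.Dart => G.connectedComponentMk d.fst)
      (fun _ _ h => R.component_sameCycle h) q
  | Sum.inr v => G.connectedComponentMk v.1

/-- The Euler characteristic `#vertices - #edges + #faces` of the closed surface into which the
rotation system embeds the connected component `c` by gluing a disc along every boundary piece. -/
noncomputable def eulerChar (R : RotationSystem G) (c : G.ConnectedComponent) : ℤ :=
  (Nat.card {v : V // G.connectedComponentMk v = c} : ℤ)
    - (Nat.card {e : G.edgeSet // ∀ v ∈ (e : Sym2 V), G.connectedComponentMk v = c} : ℤ)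
    + (Nat.card {b : R.BoundaryPiece // R.component b = c} : ℤ)

end RotationSystem

/-- A plane embedding of a finite graph, possibly disconnected, with face set `F`, up to
homeomorphism of the sphere. Every component is embedded in the sphere (a rotation system of Euler
characteristic 2), and `face` tells which face each boundary piece bounds. A face of a disconnected
plane graph may have several boundary pieces, but at most one on each component; and components
and faces, joined when the component meets the boundary of the face, form a tree (the way the
components are placed in each other's faces). -/
structure PlaneEmbedding [Finite V] (G : SimpleGraph V) (F : Type w)
    extends RotationSystem G where
  eulerChar_eq_two : ∀ c : G.ConnectedComponent, toRotationSystem.eulerChar c = 2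
  face : toRotationSystem.BoundaryPiece → F
  eq_of_face_eq : ∀ b b', toRotationSystem.component b = toRotationSystem.component b' →
    face b = face b' → b = b'
  isTree : (SimpleGraph.fromRel fun x y : G.ConnectedComponent ⊕ F =>
    ∃ b, x = Sum.inl (toRotationSystem.component b) ∧ y = Sum.inr (face b)).IsTree

namespace PlaneEmbedding

variable [Finite V] {G : SimpleGraph V} {F : Type w}

/-- The face on the side of the dart `d`. The two sides of an edge are its two darts. -/
def faceOf (M : PlaneEmbedding G F) (d : G.Dart) : F :=
  M.face (Sum.inl (Quotient.mk (Equiv.Perm.SameCycle.setoid M.facePerm) d))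

/-- The degree of a face: the number of edges along its boundary, an edge that has the face on both
sides (a cut-edge) counting twice. -/
noncomputable def faceDegree (M : PlaneEmbedding G F) (f : F) : ℕ :=
  Nat.card {d : G.Dart // M.faceOf d = f}

/-- `a b c d` is a 4-face: a face of degree 4 whose boundary edges form the 4-cycle `a b c d`, in
this order. Isolated vertices of `G` may lie in the face. -/
def IsFourFace (M : PlaneEmbedding G F) (a b c d : V) : Prop :=
  a ≠ c ∧ b ≠ d ∧
  ∃ (hab : G.Adj a b) (hbc : G.Adj b c) (hcd : G.Adj c d) (hda : G.Adj d a),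
    M.facePerm ⟨(a, b), hab⟩ = ⟨(b, c), hbc⟩ ∧
    M.facePerm ⟨(b, c), hbc⟩ = ⟨(c, d), hcd⟩ ∧
    M.facePerm ⟨(c, d), hcd⟩ = ⟨(d, a), hda⟩ ∧
    M.facePerm ⟨(d, a), hda⟩ = ⟨(a, b), hab⟩ ∧
    M.faceDegree (M.faceOf ⟨(a, b), hab⟩) = 4

end PlaneEmbedding

/-- `T` is (the vertex set of) a triangle, that is a 3-cycle, of type `(a, b, c)`: its vertices have
degrees `a`, `b`, `c` in some order. -/
def IsTriangleOfType [Fintype V] (G : SimpleGraph V) [DecidableRel G.Adj]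
    (T : Finset V) (a b c : ℕ) : Prop :=
  G.IsNClique 3 T ∧ T.val.map (fun v => G.degree v) = {a, b, c}

end SimpleGraph

/-! The proof is by discharging. Suppose that all three conclusions fail. Give charge 6(d(v) - 4) to
every non-isolated vertex and 6(deg f - 4) to every face. By Euler's formula (`card_dart_lt`) the
total is negative, yet charge can be moved so that no vertex and no face ends up negative
(`vertex_charge`, `face_charge`; to stay in ℕ, losses stand on the left and gains on the right).

Adjacent degrees now add up to at least 9, so non-isolated vertices have degrees 3 to 6 and the
neighbours of a 3-vertex have degree 6. Triangular faces and 3-vertices lack 6 each. A triangular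
face gets 3 from each of two vertices if its third has degree at most 4, and 2 from all three
otherwise. A 3-vertex gets 3 for every corner in a face of degree at least 5, and from each
neighbour 2 minus the number of these corners, but never less than 0.

The critical case is a 6-vertex, with charge 12. Without kites, at most three of its corners are
triangular; without 4-faces having opposite 3-vertices, it sends at most 6 along its edges
(`sum_edgeCharge_le`). This suffices for at most two triangular corners. With three, every edge at
the vertex bounds exactly one of them, and a corner costs at most 5 for type (6,6,3), 3 for (6,5,4)
or (6,6,4), and 2 otherwise (`corner_charge`). The failure of (iii) keeps the sum within 12. -/

section

open Finset

namespace SimpleGraph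

namespace PlaneEmbedding

/-! ### Euler's formula for disconnected plane graphs -/

section Euler

variable {V : Type u} [Finite V] {G : SimpleGraph V} {F : Type w} (M : PlaneEmbedding G F)

theorem natCard_eq_sum_fiber {α β : Type*} [Finite α] [Fintype β] (f : α → β) :
    Nat.card α = ∑ b, Nat.card {a // f a = b} := by
  rw [← Nat.card_sigma, Nat.card_congr (Equiv.sigmaFiberEquiv f)]

instance finite_dart : Finite G.Dart :=
  Finite.of_injective (fun d : G.Dart => d.toProd) fun _ _ h => Dart.ext _ _ h

instance finite_boundaryPiece : Finite M.BoundaryPiece := by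
  have : Finite M.FacialWalk := Quotient.finite _
  infer_instance

/-- Euler's formula, summed over the components. -/
theorem card_sub_card_add_card_boundaryPiece :
    (Nat.card V : ℤ) - Nat.card G.edgeSet + Nat.card M.BoundaryPiece =
      2 * Nat.card G.ConnectedComponent := by
  classical
  have := Fintype.ofFinite G.ConnectedComponent
  -- Both ends of an edge lie in one component, so either end may be chosen to sort the edges by
  -- component.
  let t : G.edgeSet → G.ConnectedComponent := fun e => G.connectedComponentMk e.1.out.1
  have ht (e : G.edgeSet) (c : G.ConnectedComponent) :
      (∀ v ∈ (e : Sym2 V), G.connectedComponentMk v = c) ↔ t e = c := by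
    refine ⟨fun h => h _ (Sym2.out_fst_mem _), ?_⟩
    rintro rfl v hv
    obtain ⟨e, he⟩ := e
    have h1 : e.out.1 ∈ e := Sym2.out_fst_mem _
    obtain ⟨y, hy⟩ := hv
    subst hy
    have hadj : G.Adj v y := he
    change G.connectedComponentMk v = G.connectedComponentMk _
    rcases Sym2.mem_iff.1 h1 with h | h
    · rw [h]
    · rw [h]
      exact ConnectedComponent.sound hadj.reachable
  have key : ∑ c, M.eulerChar c = ∑ _c : G.ConnectedComponent, (2 : ℤ) :=
    Finset.sum_congr rfl fun c _ => M.eulerChar_eq_two c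
  simp only [RotationSystem.eulerChar, Finset.sum_add_distrib, Finset.sum_sub_distrib, ht] at key
  rw [← Nat.cast_sum, ← Nat.cast_sum, ← Nat.cast_sum, ← natCard_eq_sum_fiber,
    ← natCard_eq_sum_fiber, ← natCard_eq_sum_fiber] at key
  rw [key, Nat.card_eq_fintype_card]
  simp [mul_comm]

theorem _root_.SimpleGraph.Reachable.eq_of_isolated {W : Type*} {H : SimpleGraph W} {v w : W}
    (h : H.Reachable v w) (hv : ∀ x, ¬ H.Adj v x) : v = w := by
  obtain ⟨p⟩ := h
  cases p with
  | nil => rfl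
  | cons h _ => exact absurd h (hv _)

/-- In a graph with an edge, every face has an edge on its boundary. -/
theorem exists_faceOf_eq (d : G.Dart) (f : F) : ∃ e, M.faceOf e = f := by
  by_contra! hf
  -- If only isolated vertices bounded `f`, then `f` and these vertices would be closed under
  -- adjacency in the tree, hence all of it; but the component of `d` is not among them.
  let S : G.ConnectedComponent ⊕ F → Prop := fun x => x = Sum.inr f ∨
    ∃ v : {v : V // ∀ x, ¬ G.Adj v x},
      x = Sum.inl (G.connectedComponentMk v.1) ∧ M.face (Sum.inr v) = f
  have hface (b : M.BoundaryPiece) (hb : M.face b = f) : S (Sum.inl (M.component b)) := by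
    obtain q | v := b
    · induction q using Quotient.inductionOn with
      | h e => exact absurd hb (hf e)
    · exact Or.inr ⟨v, rfl, hb⟩
  have hpiece (b : M.BoundaryPiece) (hb : S (Sum.inl (M.component b))) : M.face b = f := by
    obtain hb | ⟨v, hv, hvf⟩ := hb
    · cases hb
    · have : b = Sum.inr v := by
        obtain q | z := b
        · induction q using Quotient.inductionOn with
          | h e =>
            have hr : G.Reachable v.1 e.fst :=
              ConnectedComponent.exact (Sum.inl_injective hv).symm
            exact absurd (hr.eq_of_isolated v.2 ▸ e.adj) (v.2 _)
        · have hr : G.Reachable v.1 z.1 := ConnectedComponent.exact (Sum.inl_injective hv).symm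
          have := hr.eq_of_isolated v.2
          rw [Subtype.ext this]
      rw [this, hvf]
  have hstep (x y : G.ConnectedComponent ⊕ F) (hx : S x)
      (h : ∃ b, x = Sum.inl (M.component b) ∧ y = Sum.inr (M.face b) ∨
        y = Sum.inl (M.component b) ∧ x = Sum.inr (M.face b)) : S y := by
    obtain ⟨b, ⟨rfl, rfl⟩ | ⟨rfl, rfl⟩⟩ := h
    · exact Or.inl (by rw [hpiece b hx])
    · refine hface b ?_
      obtain hx | ⟨_, hx, _⟩ := hx
      · exact Sum.inr_injective hx
      · cases hx
  have hall (x y : G.ConnectedComponent ⊕ F) (p : (fromRel fun x y : G.ConnectedComponent ⊕ F =>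
      ∃ b, x = Sum.inl (M.component b) ∧ y = Sum.inr (M.face b)).Walk x y) : S x → S y := by
    induction p with
    | nil => exact id
    | cons h _ ih =>
      refine fun hx => ih (hstep _ _ hx ?_)
      obtain ⟨_, ⟨b, h⟩ | ⟨b, h⟩⟩ := (fromRel_adj _ _ _).1 h
      · exact ⟨b, Or.inl h⟩
      · exact ⟨b, Or.inr h⟩
  obtain ⟨p⟩ := M.isTree.connected.preconnected (Sum.inr f)
    (Sum.inl (G.connectedComponentMk d.fst))
  exact hf d (hpiece (Sum.inl (Quotient.mk _ d)) (hall _ _ p (Or.inl rfl)))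

/-- The number of boundary pieces, from the tree of components and faces. -/
theorem card_boundaryPiece_add_one [Finite F] :
    Nat.card M.BoundaryPiece + 1 = Nat.card G.ConnectedComponent + Nat.card F := by
  have h := (isTree_iff_connected_and_card.1 M.isTree).2
  rw [Nat.card_sum] at h
  rw [← h]
  congr 1
  let t : M.BoundaryPiece → (fromRel fun x y : G.ConnectedComponent ⊕ F =>
      ∃ b, x = Sum.inl (M.component b) ∧ y = Sum.inr (M.face b)).edgeSet := fun b =>
    ⟨s(Sum.inl (M.component b), Sum.inr (M.face b)),
      (mem_edgeSet _).2 ((fromRel_adj _ _ _).2 ⟨by simp, Or.inl ⟨b, rfl, rfl⟩⟩)⟩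
  -- Boundary pieces are the edges of the tree: `eq_of_face_eq` rules out parallel ones.
  refine Nat.card_congr (Equiv.ofBijective t ⟨fun b b' hb => ?_, ?_⟩)
  · have hb := congrArg Subtype.val hb
    simp only [t, Sym2.eq_iff, Sum.inl.injEq, Sum.inr.injEq, reduceCtorEq, and_self,
      or_false] at hb
    exact M.eq_of_face_eq b b' hb.1 hb.2
  · rintro ⟨e, he⟩
    induction e using Sym2.ind with
    | _ x y =>
      obtain ⟨_, ⟨b, rfl, rfl⟩ | ⟨b, rfl, rfl⟩⟩ := (fromRel_adj _ _ _).1 ((mem_edgeSet _).1 he)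
      · exact ⟨b, rfl⟩
      · exact ⟨b, Subtype.ext Sym2.eq_swap⟩

end Euler

/-- Euler's formula, as an inequality for the numbers of darts, of non-isolated vertices and of
faces. -/
theorem card_dart_lt {V : Type u} [Fintype V] {G : SimpleGraph V} [DecidableRel G.Adj]
    {F : Type w} [Fintype F] (M : PlaneEmbedding G F) :
    Fintype.card G.Dart < 2 * #{v : V | 0 < G.degree v} + 2 * Fintype.card F := by
  classical
  have h1 := M.card_sub_card_add_card_boundaryPiece
  have h2 := M.card_boundaryPiece_add_one
  have h3 := G.dart_card_eq_twice_card_edges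
  have h4 : Nat.card G.edgeSet = #G.edgeFinset := by
    rw [Nat.card_eq_fintype_card, edgeFinset_card]
  have h5 : #{v : V | 0 < G.degree v} + #{v : V | ¬ 0 < G.degree v} = Fintype.card V :=
    card_filter_add_card_filter_not _
  -- Euler gives V - E + F = C + 1 with C components. Each isolated vertex is a component, so
  -- dropping all of them still leaves at least 1.
  have h6 : #{v : V | ¬ 0 < G.degree v} ≤ Nat.card G.ConnectedComponent := by
    rw [Nat.card_eq_fintype_card]
    refine card_le_card_of_injOn G.connectedComponentMk (fun _ _ => mem_univ _) ?_
    intro v hv w _ h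
    have hr : G.Reachable v w := ConnectedComponent.exact h
    refine hr.eq_of_isolated fun x hx => ?_
    exact absurd ((G.degree_pos_iff_exists_adj v).2 ⟨_, hx⟩) (by simpa using hv)
  rw [Nat.card_eq_fintype_card (α := V)] at h1
  rw [Nat.card_eq_fintype_card (α := F)] at h2
  omega

end PlaneEmbedding
end SimpleGraph

end

/-! ### Corners, triangular faces and 4-faces -/

section

open Finset

namespace SimpleGraph

variable {V : Type u} {G : SimpleGraph V}

namespace RotationSystem

variable (R : RotationSystem G)

theorem facePerm_apply (d : G.Dart) : R.facePerm d = R.next d.symm := rfl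

theorem facePerm_symm_apply (d : G.Dart) : R.facePerm.symm d = (R.next.symm d).symm := by
  rw [Equiv.symm_apply_eq, facePerm_apply, Dart.symm_symm, Equiv.apply_symm_apply]

theorem next_symm_fst (d : G.Dart) : (R.next.symm d).fst = d.fst := by
  rw [← R.next_fst, Equiv.apply_symm_apply]

theorem facePerm_ne_self (d : G.Dart) : R.facePerm d ≠ d := fun h =>
  G.ne_of_adj d.adj (by rw [← R.facePerm_fst d, h])

variable [Fintype V] [DecidableRel G.Adj]

/-- A set of darts that is closed under rotation contains all darts at a vertex, if it contains
one of them. -/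
theorem degree_le_card (S : Finset G.Dart) {d : G.Dart} (hd : d ∈ S)
    (hS : ∀ e ∈ S, R.next e ∈ S) : G.degree d.fst ≤ #S := by
  classical
  rw [← dart_fst_fiber_card_eq_degree]
  refine card_le_card fun e he => ?_
  obtain ⟨i, -, -, rfl⟩ := ((R.sameCycle_iff d e).2 (mem_filter.1 he).2.symm).exists_pow_eq''
  clear he
  induction i with
  | zero => exact hd
  | succ i ih =>
    rw [pow_succ', Equiv.Perm.mul_apply]
    exact hS _ ih

theorem next_ne_self {d : G.Dart} (h : 2 ≤ G.degree d.fst) : R.next d ≠ d := fun hd => by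
  have := R.degree_le_card {d} (mem_singleton_self d) (by simp [hd])
  rw [card_singleton] at this
  omega

theorem next_next_ne_self {d : G.Dart} (h : 3 ≤ G.degree d.fst) : R.next (R.next d) ≠ d :=
  fun hd => by
    classical
    have := R.degree_le_card {d, R.next d} (mem_insert_self d _) (by simp [hd])
    have := card_le_two (a := d) (b := R.next d)
    omega

/-- A facial walk turns back only at a vertex of degree 1. -/
theorem facePerm_facePerm_fst_ne {d : G.Dart} (h : 2 ≤ G.degree d.snd) :
    (R.facePerm (R.facePerm d)).fst ≠ d.fst := fun hd => by
  refine R.next_ne_self (d := d.symm) h ?_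
  rw [R.facePerm_fst] at hd
  refine Dart.ext _ _ (Prod.ext ?_ ?_)
  · exact R.next_fst _
  · exact hd

theorem facePerm_facePerm_ne_self {d : G.Dart} (h : 2 ≤ G.degree d.snd) :
    R.facePerm (R.facePerm d) ≠ d := fun hd =>
  R.facePerm_facePerm_fst_ne h (by rw [hd])

end RotationSystem

namespace PlaneEmbedding

variable [Fintype V] {F : Type w} (M : PlaneEmbedding G F)

@[simp]
theorem faceOf_facePerm (d : G.Dart) : M.faceOf (M.facePerm d) = M.faceOf d := by
  refine congrArg (fun q => M.face (Sum.inl q)) (Quotient.sound ?_)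
  exact (Equiv.Perm.sameCycle_apply_left.2 (Equiv.Perm.SameCycle.refl _ _) :
    M.facePerm.SameCycle (M.facePerm d) d)

theorem faceOf_symm (d : G.Dart) : M.faceOf d.symm = M.faceOf (M.next d) := by
  rw [← M.faceOf_facePerm, M.facePerm_apply, Dart.symm_symm]

variable [DecidableRel G.Adj]

open Classical in
theorem faceDegree_eq_card (f : F) : M.faceDegree f = #{d : G.Dart | M.faceOf d = f} := by
  rw [faceDegree, Nat.card_eq_fintype_card, Fintype.card_subtype]

variable {M}

/-- If all degrees of non-isolated vertices are at least 3, then so are the face degrees. -/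
theorem three_le_faceDegree (hdeg : ∀ v w, G.Adj v w → 3 ≤ G.degree v) (d : G.Dart) :
    3 ≤ M.faceDegree (M.faceOf d) := by
  classical
  rw [faceDegree_eq_card, ← card_eq_three.2 ⟨d, M.facePerm d, M.facePerm (M.facePerm d),
    (M.facePerm_ne_self _).symm, (M.facePerm_facePerm_ne_self ?_).symm,
    (M.facePerm_ne_self _).symm, rfl⟩]
  · exact card_le_card (by intro; simp; rintro (rfl | rfl | rfl) <;> simp)
  · exact le_trans (by norm_num) (hdeg _ _ d.adj.symm)

/-- The first three darts of the walk are distinct, so they exhaust the face and the walk must close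
up. -/
theorem facePerm_pow_three (hdeg : ∀ v w, G.Adj v w → 3 ≤ G.degree v) {d : G.Dart}
    (h : M.faceDegree (M.faceOf d) = 3) : M.facePerm (M.facePerm (M.facePerm d)) = d := by
  classical
  have h2 (e : G.Dart) : M.facePerm (M.facePerm e) ≠ e :=
    M.facePerm_facePerm_ne_self (le_trans (by norm_num) (hdeg _ _ e.adj.symm))
  have hS : ({d, M.facePerm d, M.facePerm (M.facePerm d)} : Finset G.Dart) =
      ({e | M.faceOf e = M.faceOf d} : Finset G.Dart) := by
    refine eq_of_subset_of_card_le (by intro; simp; rintro (rfl | rfl | rfl) <;> simp) ?_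
    rw [← faceDegree_eq_card, h, card_eq_three.2 ⟨d, M.facePerm d, M.facePerm (M.facePerm d),
      (M.facePerm_ne_self _).symm, (h2 _).symm, (M.facePerm_ne_self _).symm, rfl⟩]
  have hmem : M.facePerm (M.facePerm (M.facePerm d)) ∈
      ({e | M.faceOf e = M.faceOf d} : Finset G.Dart) := by simp
  rw [← hS] at hmem
  simp only [mem_insert, mem_singleton] at hmem
  obtain h | h | h := hmem
  · exact h
  · exact absurd h (h2 _)
  · exact absurd h (M.facePerm_ne_self _)

theorem facePerm_pow_four (hdeg : ∀ v w, G.Adj v w → 3 ≤ G.degree v) {d : G.Dart}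
    (h : M.faceDegree (M.faceOf d) = 4) :
    M.facePerm (M.facePerm (M.facePerm (M.facePerm d))) = d := by
  classical
  have h1 (e : G.Dart) : M.facePerm e ≠ e := M.facePerm_ne_self e
  have h2 (e : G.Dart) : M.facePerm (M.facePerm e) ≠ e :=
    M.facePerm_facePerm_ne_self (le_trans (by norm_num) (hdeg _ _ e.adj.symm))
  have hT : #{d, M.facePerm d, M.facePerm (M.facePerm d)} = 3 :=
    card_eq_three.2 ⟨d, M.facePerm d, M.facePerm (M.facePerm d),
      (h1 _).symm, (h2 _).symm, (h1 _).symm, rfl⟩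
  have hsub : ({d, M.facePerm d, M.facePerm (M.facePerm d)} : Finset G.Dart) ⊆
      ({e | M.faceOf e = M.faceOf d} : Finset G.Dart) := by
    intro; simp; rintro (rfl | rfl | rfl) <;> simp
  rw [faceDegree_eq_card] at h
  obtain ⟨w, hw⟩ := card_eq_one.1
    (show #(({e | M.faceOf e = M.faceOf d} : Finset G.Dart) \
      {d, M.facePerm d, M.facePerm (M.facePerm d)}) = 1 by
      rw [card_sdiff_of_subset hsub, h, hT])
  have hall (e : G.Dart) (he : M.faceOf e = M.faceOf d) :
      e = w ∨ e = d ∨ e = M.facePerm d ∨ e = M.facePerm (M.facePerm d) := by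
    by_contra! hne
    have : e ∈ ({w} : Finset G.Dart) := by
      rw [← hw]
      simp [he, hne.2.1, hne.2.2.1, hne.2.2.2]
    exact hne.1 (mem_singleton.1 this)
  have hwf : w ∈ ({e | M.faceOf e = M.faceOf d} : Finset G.Dart) \
      {d, M.facePerm d, M.facePerm (M.facePerm d)} := by rw [hw]; exact mem_singleton_self w
  simp only [mem_sdiff, mem_filter, mem_univ, true_and, mem_insert, mem_singleton,
    not_or] at hwf
  obtain ⟨hwf, hw0, hw1, hw2⟩ := hwf
  have hwd : M.facePerm w = d ∨ M.facePerm w = M.facePerm d ∨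
      M.facePerm w = M.facePerm (M.facePerm d) :=
    (hall (M.facePerm w) (by simp [hwf])).resolve_left (h1 w)
  -- The fourth dart `w` is not fixed, and by injectivity its image can only be `d`; so the face is
  -- a single 4-cycle of darts.
  have hwd : M.facePerm w = d := by
    obtain h | h | h := hwd
    · exact h
    · exact absurd (M.facePerm.injective h) hw0
    · exact absurd (M.facePerm.injective h) hw1
  obtain h | h | h | h := hall (M.facePerm (M.facePerm (M.facePerm d))) (by simp)
  · rw [h, hwd]
  · exact absurd (M.facePerm.injective (h.trans hwd.symm)).symm hw2
  · exact absurd h (h2 _)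
  · exact absurd h (h1 _)

/-- The neighbours of `d.fst` along the two edges of the corner of a triangular face are adjacent. -/
theorem adj_of_faceDegree_eq_three (hdeg : ∀ v w, G.Adj v w → 3 ≤ G.degree v) {d : G.Dart}
    (h : M.faceDegree (M.faceOf d) = 3) : G.Adj d.snd (M.next.symm d).snd := by
  have h3 := facePerm_pow_three hdeg h
  have : M.facePerm.symm d = M.facePerm (M.facePerm d) := by rw [Equiv.symm_apply_eq, h3]
  rw [M.facePerm_symm_apply] at this
  have h4 : (M.next.symm d).snd = (M.facePerm d).snd := by
    rw [← M.facePerm_fst (M.facePerm d), ← this]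
    rfl
  rw [h4, ← M.facePerm_fst d]
  exact (M.facePerm d).adj

/-- No two consecutive corners at a vertex belong to triangular faces. -/
theorem faceDegree_next_ne_three (hdeg : ∀ v w, G.Adj v w → 3 ≤ G.degree v)
    (hkite : G.HasNoKite) {d : G.Dart} (h : M.faceDegree (M.faceOf d) = 3) :
    M.faceDegree (M.faceOf (M.next d)) ≠ 3 := fun h' => by
  have h1 := adj_of_faceDegree_eq_three hdeg h
  have h2 := adj_of_faceDegree_eq_three hdeg h'
  rw [Equiv.symm_apply_apply] at h2
  have h3 : G.Adj d.fst (M.next.symm d).snd := by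
    rw [← M.next_symm_fst d]
    exact (M.next.symm d).adj
  have h4 : G.Adj d.fst (M.next d).snd := by
    rw [← M.next_fst d]
    exact (M.next d).adj
  -- Both triangles contain the edge of `d`; without kites their third vertices agree, which would
  -- force degree at most 2 at `d.fst`.
  have h5 := hkite _ _ _ _ d.adj h3 h1 h4 h2.symm
  refine M.next_next_ne_self (hdeg _ _ d.adj) (d := d) ?_
  have h6 : M.next.symm d = M.next d := by
    refine Dart.ext _ _ (Prod.ext ?_ h5)
    exact (M.next_symm_fst d).trans (M.next_fst d).symm
  rw [← h6, Equiv.apply_symm_apply]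

/-- A corner of a face of degree 4 is a corner of a 4-cycle that bounds the face. -/
theorem isFourFace_of_faceDegree_eq_four (hdeg : ∀ v w, G.Adj v w → 3 ≤ G.degree v)
    {d : G.Dart} (h : M.faceDegree (M.faceOf d) = 4) :
    ∃ x, M.IsFourFace (M.next.symm d).snd d.fst d.snd x := by
  have h4 := facePerm_pow_four hdeg h
  have hprev : M.facePerm (M.next.symm d).symm = d := by
    rw [← M.facePerm_symm_apply, Equiv.apply_symm_apply]
  have h3 : M.facePerm (M.facePerm (M.facePerm d)) = (M.next.symm d).symm :=
    M.facePerm.injective (h4.trans hprev.symm)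
  have hab : (M.next.symm d).fst = d.fst := M.next_symm_fst d
  have hbc : (M.facePerm d).fst = d.snd := M.facePerm_fst d
  have hcx : (M.facePerm (M.facePerm d)).fst = (M.facePerm d).snd := M.facePerm_fst _
  have hxa : (M.facePerm (M.facePerm d)).snd = (M.next.symm d).snd := by
    rw [← M.facePerm_fst, h3]
    rfl
  have hdarts (e : G.Dart) {v w : V} (hv : e.fst = v) (hw : e.snd = w) (hvw : G.Adj v w) :
      (⟨(v, w), hvw⟩ : G.Dart) = e := Dart.ext _ _ (Prod.ext hv.symm hw.symm)
  have had1 : G.Adj (M.next.symm d).snd d.fst := hab ▸ (M.next.symm d).adj.symm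
  have had2 : G.Adj d.snd (M.facePerm d).snd := hbc ▸ (M.facePerm d).adj
  have had3 : G.Adj (M.facePerm d).snd (M.next.symm d).snd := by
    rw [← hcx, ← hxa]
    exact (M.facePerm (M.facePerm d)).adj
  refine ⟨(M.facePerm d).snd, fun hac => ?_, ?_, had1, d.adj, had2, had3, ?_⟩
  · refine M.next_ne_self (d := d) (le_trans (by norm_num) (hdeg _ _ d.adj)) ?_
    have : M.next.symm d = d := Dart.ext _ _ (Prod.ext hab hac)
    exact ((Equiv.symm_apply_eq _).1 this).symm
  · rw [← hcx]
    exact (M.facePerm_facePerm_fst_ne (le_trans (by norm_num) (hdeg _ _ d.adj.symm))).symm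
  · rw [hdarts (M.next.symm d).symm (v := (M.next.symm d).snd) rfl hab had1, hdarts d rfl rfl d.adj,
      hdarts (M.facePerm d) hbc rfl had2, hdarts (M.facePerm (M.facePerm d)) hcx hxa had3]
    refine ⟨hprev, rfl, rfl, h3, ?_⟩
    rw [← M.faceOf_facePerm, hprev, h]

end PlaneEmbedding
end SimpleGraph

end

/-! ### Discharging rules, faces and 3-vertices -/

section

open Finset

namespace SimpleGraph

variable {V : Type u} [Fintype V] {G : SimpleGraph V} [DecidableRel G.Adj]

open Classical in
theorem RotationSystem.sum_next_symm (R : RotationSystem G) (v : V) (f : G.Dart → ℕ) :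
    ∑ d : G.Dart with d.fst = v, f (R.next.symm d) = ∑ d : G.Dart with d.fst = v, f d :=
  Finset.sum_equiv R.next.symm (by simp [R.next_symm_fst]) (by simp)

open Classical in
theorem RotationSystem.sum_next (R : RotationSystem G) (v : V) (f : G.Dart → ℕ) :
    ∑ d : G.Dart with d.fst = v, f (R.next d) = ∑ d : G.Dart with d.fst = v, f d :=
  Finset.sum_equiv R.next (by simp [R.next_fst]) (by simp)

theorem Dart.snd_symm {W : Type*} {H : SimpleGraph W} (d : H.Dart) : d.symm.snd = d.fst := rfl

open Classical in
theorem card_dart_fst (v : V) : #{d : G.Dart | d.fst = v} = G.degree v := by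
  rw [← dart_fst_fiber_card_eq_degree]

namespace PlaneEmbedding

variable {F : Type w}

section Charges

variable (M : PlaneEmbedding G F)

/-- The charge that the vertex `d.fst` sends to a triangular face, through the corner between `d`
and its predecessor in the rotation. -/
noncomputable def triangleCharge (d : G.Dart) : ℕ :=
  if M.faceDegree (M.faceOf d) = 3 then
    -- As adjacent degrees will add up to at least 9, at most one vertex of the triangle has degree
    -- at most 4: the face gets 3 + 3 or 2 + 2 + 2.
    if G.degree d.snd ≤ 4 ∨ G.degree (M.next.symm d).snd ≤ 4 then 3
    else if G.degree d.fst ≤ 4 then 0 else 2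
  else 0

/-- The charge that a face of degree at least 5 sends to a vertex of degree 3, through the corner
at `d`. -/
noncomputable def longFaceCharge (d : G.Dart) : ℕ :=
  if 5 ≤ M.faceDegree (M.faceOf d) ∧ G.degree d.fst = 3 then 3 else 0

open Classical in
/-- The number of corners at `v` in faces of degree at least 5. -/
noncomputable def longCorners (v : V) : ℕ :=
  #{d : G.Dart | d.fst = v ∧ 5 ≤ M.faceDegree (M.faceOf d)}

/-- The charge that `d.fst` sends to its neighbour `d.snd` of degree 3. -/
noncomputable def edgeCharge (d : G.Dart) : ℕ :=
  -- The subtraction is truncated: with three long corners nothing is needed from the neighbours.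
  if G.degree d.snd = 3 then 2 - M.longCorners d.snd else 0

end Charges

variable {M : PlaneEmbedding G F}

section Degrees

variable (hsum : ∀ v w, G.Adj v w → 9 ≤ G.degree v + G.degree w) (hmax : ∀ v, G.degree v ≤ 6)

include hsum hmax in
theorem three_le_degree (v w : V) (h : G.Adj v w) : 3 ≤ G.degree v := by
  have := hsum v w h
  have := hmax w
  omega

open Classical in
theorem face_charge (hsum : ∀ v w, G.Adj v w → 9 ≤ G.degree v + G.degree w)
    (hmax : ∀ v, G.degree v ≤ 6) (d : G.Dart) :
    24 + ∑ e : G.Dart with M.faceOf e = M.faceOf d, M.longFaceCharge e ≤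
      6 * #{e : G.Dart | M.faceOf e = M.faceOf d} +
        ∑ e : G.Dart with M.faceOf e = M.faceOf d, M.triangleCharge e := by
  have hdeg := three_le_degree hsum hmax
  have h3 := three_le_faceDegree (M := M) hdeg d
  have hcard := M.faceDegree_eq_card (M.faceOf d)
  by_cases h : M.faceDegree (M.faceOf d) = 3
  · have hb : ∑ e : G.Dart with M.faceOf e = M.faceOf d, M.longFaceCharge e = 0 := by
      refine sum_eq_zero fun e he => ?_
      rw [longFaceCharge, (mem_filter.1 he).2, h, if_neg (by omega)]
    have h2 (e : G.Dart) : M.facePerm (M.facePerm e) ≠ e :=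
      M.facePerm_facePerm_ne_self (le_trans (by norm_num) (hdeg _ _ e.adj.symm))
    have h1 := M.facePerm_ne_self
    have hT : #{d, M.facePerm d, M.facePerm (M.facePerm d)} = 3 :=
      card_eq_three.2 ⟨_, _, _, (h1 _).symm, (h2 _).symm, (h1 _).symm, rfl⟩
    have hsub : ({d, M.facePerm d, M.facePerm (M.facePerm d)} : Finset G.Dart) ⊆
        ({e | M.faceOf e = M.faceOf d} : Finset G.Dart) := by
      intro; simp; rintro (rfl | rfl | rfl) <;> simp
    have ha := sum_le_sum_of_subset (f := M.triangleCharge) hsub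
    rw [sum_insert (by simp [(h1 _).symm, (h2 _).symm]), sum_insert (by simp [(h1 _).symm]),
      sum_singleton] at ha
    have h4 := facePerm_pow_three hdeg h
    have hprev (e : G.Dart) : M.next.symm (M.facePerm e) = e.symm := by
      rw [M.facePerm_apply, Equiv.symm_apply_apply]
    have hp0 : G.degree (M.next.symm d).snd = G.degree (M.facePerm (M.facePerm d)).fst := by
      conv_lhs => rw [← h4, hprev, Dart.snd_symm]
    have hp1 : G.degree (M.next.symm (M.facePerm d)).snd = G.degree d.fst := by
      rw [hprev, Dart.snd_symm]
    have hp2 : G.degree (M.next.symm (M.facePerm (M.facePerm d))).snd =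
        G.degree (M.facePerm d).fst := by rw [hprev, Dart.snd_symm]
    have hs0 : G.degree (M.facePerm d).fst = G.degree d.snd := by rw [M.facePerm_fst]
    have hs1 : G.degree (M.facePerm (M.facePerm d)).fst = G.degree (M.facePerm d).snd := by
      rw [M.facePerm_fst]
    have hs2 : G.degree d.fst = G.degree (M.facePerm (M.facePerm d)).snd := by
      rw [← M.facePerm_fst, h4]
    have ha0 := hsum _ _ d.adj
    have ha1 := hsum _ _ (M.facePerm d).adj
    have ha2 := hsum _ _ (M.facePerm (M.facePerm d)).adj
    simp only [triangleCharge, faceOf_facePerm, h, if_true] at ha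
    have : 6 ≤ ∑ e : G.Dart with M.faceOf e = M.faceOf d, M.triangleCharge e := by
      refine le_trans ?_ ha
      split_ifs <;> omega
    omega
  · by_cases h' : 5 ≤ M.faceDegree (M.faceOf d)
    -- Consecutive vertices of the walk are adjacent, hence not both of degree 3.
    · have hb (e : G.Dart) : M.longFaceCharge e + M.longFaceCharge (M.facePerm e) ≤ 3 := by
        have := hsum _ _ e.adj
        have hs : G.degree (M.facePerm e).fst = G.degree e.snd := by rw [M.facePerm_fst]
        simp only [longFaceCharge, faceOf_facePerm]
        split_ifs <;> omega
      have hshift : ∑ e : G.Dart with M.faceOf e = M.faceOf d, M.longFaceCharge (M.facePerm e) =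
          ∑ e : G.Dart with M.faceOf e = M.faceOf d, M.longFaceCharge e :=
        sum_equiv M.facePerm (by simp) (by simp)
      have := sum_le_card_nsmul ({e : G.Dart | M.faceOf e = M.faceOf d} : Finset G.Dart) _ 3
        fun e _ => hb e
      -- Needed for degree 5: twice the sum is at most 15, and divisibility by 3 lowers the sum to 6
      -- = 6 * 5 - 24.
      have h3 : 3 ∣ ∑ e : G.Dart with M.faceOf e = M.faceOf d, M.longFaceCharge e :=
        dvd_sum fun e _ => by rw [longFaceCharge]; split_ifs <;> simp
      rw [sum_add_distrib, hshift, smul_eq_mul] at this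
      omega
    · have hb : ∑ e : G.Dart with M.faceOf e = M.faceOf d, M.longFaceCharge e = 0 := by
        refine sum_eq_zero fun e he => ?_
        rw [longFaceCharge, (mem_filter.1 he).2, if_neg (by omega)]
      omega

theorem edgeCharge_of_ne {d : G.Dart} (h : G.degree d.snd ≠ 3) : M.edgeCharge d = 0 :=
  if_neg h

theorem edgeCharge_le (d : G.Dart) : M.edgeCharge d ≤ 2 := by
  rw [edgeCharge]
  split_ifs <;> omega

theorem triangleCharge_le (d : G.Dart) :
    M.triangleCharge d ≤ 3 * if M.faceDegree (M.faceOf d) = 3 then 1 else 0 := by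
  rw [triangleCharge]
  split_ifs <;> omega

open Classical in
theorem three_vertex_charge (hsum : ∀ v w, G.Adj v w → 9 ≤ G.degree v + G.degree w) {v : V}
    (hv : G.degree v = 3) :
    24 + ∑ d : G.Dart with d.fst = v, (M.triangleCharge d + M.edgeCharge d) ≤
      6 * #{d : G.Dart | d.fst = v} +
        ∑ d : G.Dart with d.fst = v, (M.longFaceCharge d + M.edgeCharge d.symm) := by
  have hout : ∑ d : G.Dart with d.fst = v, (M.triangleCharge d + M.edgeCharge d) = 0 := by
    refine sum_eq_zero fun d hd => ?_
    obtain rfl := (mem_filter.1 hd).2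
    have h1 := hsum _ _ d.adj
    have h2 := hsum _ _ (M.next.symm d).adj
    rw [M.next_symm_fst] at h2
    rw [edgeCharge_of_ne (by omega), triangleCharge]
    split_ifs <;> omega
  have hin : ∑ d : G.Dart with d.fst = v, M.longFaceCharge d = 3 * M.longCorners v := by
    rw [longCorners, ← filter_filter, card_eq_sum_ones, mul_sum, sum_filter (p := fun d =>
      5 ≤ M.faceDegree (M.faceOf d))]
    refine sum_congr rfl fun d hd => ?_
    rw [longFaceCharge, (mem_filter.1 hd).2]
    simp [hv]
  have hin' : ∑ d : G.Dart with d.fst = v, M.edgeCharge d.symm = 3 * (2 - M.longCorners v) := by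
    rw [← hv, ← card_dart_fst, ← smul_eq_mul, ← sum_const]
    refine sum_congr rfl fun d hd => ?_
    rw [edgeCharge, Dart.snd_symm, (mem_filter.1 hd).2, if_pos hv]
  rw [hout, sum_add_distrib, hin, hin', card_dart_fst, hv]
  omega

/-! ### Charge sent along the edges at a vertex -/

section Six

variable (hfour : ∀ a b c d, M.IsFourFace a b c d → G.degree a = 3 → G.degree c ≠ 3)

include hsum hmax hfour

/-- Two 3-vertices are not adjacent, so the face between them is no triangle, and a 4-face would
have them as opposite corners. -/
theorem five_le_faceDegree_next {d : G.Dart} (h : G.degree d.snd = 3)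
    (h' : G.degree (M.next d).snd = 3) : 5 ≤ M.faceDegree (M.faceOf (M.next d)) := by
  have hdeg := three_le_degree hsum hmax
  have h3 := three_le_faceDegree (M := M) hdeg (M.next d)
  have hne3 : M.faceDegree (M.faceOf (M.next d)) ≠ 3 := fun hf => by
    have := hsum _ _ (adj_of_faceDegree_eq_three hdeg hf)
    rw [Equiv.symm_apply_apply] at this
    omega
  have hne4 : M.faceDegree (M.faceOf (M.next d)) ≠ 4 := fun hf => by
    obtain ⟨x, hx⟩ := isFourFace_of_faceDegree_eq_four hdeg hf
    rw [Equiv.symm_apply_apply] at hx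
    exact hfour _ _ _ _ hx h h'
  omega

omit hfour in
-- The faces on the two sides of the edge have distinct corners at `d.snd`, and each long one lowers
-- the demand of that 3-vertex by 1.
theorem edgeCharge_add_le (d : G.Dart) : M.edgeCharge d +
    (if 5 ≤ M.faceDegree (M.faceOf d) then 1 else 0) +
    (if 5 ≤ M.faceDegree (M.faceOf (M.next d)) then 1 else 0) ≤ 2 := by
  classical
  have hdeg := three_le_degree hsum hmax
  by_cases h3 : G.degree d.snd = 3
  · have hne : M.facePerm d ≠ d.symm :=
      M.next_ne_self (d := d.symm) (le_trans (by norm_num) (hdeg _ _ d.symm.adj))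
    have hsub : ({d.symm, M.facePerm d} : Finset G.Dart).filter
        (fun e => 5 ≤ M.faceDegree (M.faceOf e)) ⊆
        ({e : G.Dart | e.fst = d.snd ∧ 5 ≤ M.faceDegree (M.faceOf e)} : Finset G.Dart) := by
      intro e he
      obtain ⟨he, h5⟩ := mem_filter.1 he
      refine mem_filter.2 ⟨mem_univ _, ?_, h5⟩
      rcases mem_insert.1 he with rfl | he
      · rfl
      · rw [mem_singleton.1 he, M.facePerm_fst]
    have := card_le_card hsub
    rw [card_filter, sum_pair hne.symm, M.faceOf_symm, M.faceOf_facePerm] at this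
    rw [edgeCharge, if_pos h3, longCorners]
    split_ifs at this ⊢ <;> omega
  · rw [edgeCharge_of_ne h3]
    split_ifs <;> omega

open Classical in
/-- A vertex sends at most 2 for each block of consecutive neighbours of degree 3. -/
theorem sum_edgeCharge_le (v : V) :
    ∑ d : G.Dart with d.fst = v, M.edgeCharge d ≤ #{d : G.Dart | d.fst = v} := by
  let p : G.Dart → ℕ := fun d =>
    if G.degree d.snd = 3 ∧ G.degree (M.next d).snd = 3 then 1 else 0
  let q : G.Dart → ℕ := fun d =>
    if G.degree d.snd = 3 ∧ G.degree (M.next d).snd ≠ 3 then 1 else 0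
  -- `p` marks the pairs inside a block and `q` its last dart. Summed around the vertex, the `p`
  -- terms cancel. If all neighbours have degree 3, then `q` vanishes and nothing is sent.
  have hg (d : G.Dart) : M.edgeCharge d + p (M.next.symm d) ≤ p d + 2 * q d := by
    have h0 := edgeCharge_add_le (M := M) hsum hmax d
    have h1 := five_le_faceDegree_next (M := M) hsum hmax hfour (d := d)
    have h2 := five_le_faceDegree_next (M := M) hsum hmax hfour (d := M.next.symm d)
    have h3 := edgeCharge_of_ne (M := M) (d := d)
    rw [Equiv.apply_symm_apply] at h2
    have h4 : G.degree (M.next (M.next.symm d)).snd = G.degree d.snd := by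
      rw [Equiv.apply_symm_apply]
    simp only [p, q]
    split_ifs at h0 ⊢ <;> omega
  -- Every block is followed by a neighbour of degree other than 3, so at most half of the darts end
  -- a block.
  have hq (d : G.Dart) : q d + q (M.next.symm d) ≤ 1 := by
    have h4 : G.degree (M.next (M.next.symm d)).snd = G.degree d.snd := by
      rw [Equiv.apply_symm_apply]
    simp only [q]
    split_ifs <;> omega
  have h1 := sum_le_sum fun d (_ : d ∈ ({d : G.Dart | d.fst = v} : Finset G.Dart)) => hg d
  have h2 := sum_le_card_nsmul ({d : G.Dart | d.fst = v} : Finset G.Dart) _ 1 fun d _ => hq d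
  simp only [sum_add_distrib, M.sum_next_symm, ← mul_sum, smul_eq_mul] at h1 h2
  omega

end Six

end Degrees

end PlaneEmbedding
end SimpleGraph

end

/-! ### Triangles at a vertex and the final charges -/

section

open Finset

namespace SimpleGraph

variable {V : Type u} [Fintype V] {G : SimpleGraph V} [DecidableRel G.Adj]

open Classical in
theorem isTriangleOfType_triple {x y z : V} (hxy : G.Adj x y) (hxz : G.Adj x z) (hyz : G.Adj y z)
    {a b c : ℕ} (h : ({G.degree x, G.degree y, G.degree z} : Multiset ℕ) = {a, b, c}) :
    G.IsTriangleOfType {x, y, z} a b c := by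
  refine ⟨is3Clique_triple_iff.2 ⟨hxy, hxz, hyz⟩, ?_⟩
  rw [← h, insert_val_of_notMem (by simp [hxy.ne, hxz.ne]),
    insert_val_of_notMem (by simp [hyz.ne])]
  simp

namespace PlaneEmbedding

variable {F : Type w} {M : PlaneEmbedding G F}

/-- Of two consecutive corners at a vertex, at most one is triangular. -/
theorem triangular_add_next_le_one (hdeg : ∀ v w, G.Adj v w → 3 ≤ G.degree v)
    (hkite : G.HasNoKite) (d : G.Dart) :
    (if M.faceDegree (M.faceOf d) = 3 then 1 else 0) +
      (if M.faceDegree (M.faceOf (M.next d)) = 3 then 1 else 0) ≤ 1 := by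
  have := faceDegree_next_ne_three (M := M) hdeg hkite (d := d)
  split_ifs <;> simp_all

open Classical in
-- Summing over consecutive pairs of corners counts every corner twice.
theorem two_mul_card_triangular_le (hdeg : ∀ v w, G.Adj v w → 3 ≤ G.degree v)
    (hkite : G.HasNoKite) (v : V) :
    2 * #{d : G.Dart | d.fst = v ∧ M.faceDegree (M.faceOf d) = 3} ≤ G.degree v := by
  have h := sum_le_card_nsmul ({d : G.Dart | d.fst = v} : Finset G.Dart) _ 1
    fun d _ => triangular_add_next_le_one (M := M) hdeg hkite d
  rw [sum_add_distrib, M.sum_next v fun d => if M.faceDegree (M.faceOf d) = 3 then 1 else 0,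
    card_dart_fst, ← card_filter, filter_filter, smul_eq_mul] at h
  omega

open Classical in
theorem sum_triangleCharge_le (v : V) :
    ∑ d : G.Dart with d.fst = v, M.triangleCharge d ≤
      3 * #{d : G.Dart | d.fst = v ∧ M.faceDegree (M.faceOf d) = 3} := by
  rw [← filter_filter, card_filter, mul_sum]
  exact sum_le_sum fun d _ => triangleCharge_le d

open Classical in
/-- If half of the corners at `v` are triangular, the sum over the darts at `v` can be taken over
the pairs of darts that bound them. -/
theorem sum_eq_sum_triangular (hdeg : ∀ v w, G.Adj v w → 3 ≤ G.degree v)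
    (hkite : G.HasNoKite) {v : V}
    (hv : G.degree v = 2 * #{d : G.Dart | d.fst = v ∧ M.faceDegree (M.faceOf d) = 3})
    (f : G.Dart → ℕ) :
    ∑ d : G.Dart with d.fst = v, f d =
      ∑ d : G.Dart with d.fst = v ∧ M.faceDegree (M.faceOf d) = 3,
        (f d + f (M.next.symm d)) := by
  let t : G.Dart → ℕ := fun d => if M.faceDegree (M.faceOf d) = 3 then 1 else 0
  have hle : ∀ d ∈ ({d : G.Dart | d.fst = v} : Finset G.Dart), t d + t (M.next d) ≤ 1 :=
    fun d _ => triangular_add_next_le_one hdeg hkite d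
  have hsum : ∑ d : G.Dart with d.fst = v, (t d + t (M.next d)) =
      ∑ d : G.Dart with d.fst = v, 1 := by
    rw [sum_add_distrib, M.sum_next, ← card_eq_sum_ones, card_dart_fst, hv, ← filter_filter,
      card_filter, two_mul]
  -- Equality of the totals forces it termwise: each dart bounds exactly one triangular corner.
  have heq := (sum_eq_sum_iff_of_le hle).1 hsum
  rw [sum_add_distrib, ← filter_filter, sum_filter (p := fun d => M.faceDegree (M.faceOf d) = 3),
    sum_filter (p := fun d => M.faceDegree (M.faceOf d) = 3)]
  have h1 := M.sum_next v fun d => if M.faceDegree (M.faceOf d) = 3 then f (M.next.symm d) else 0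
  rw [← h1, ← sum_add_distrib]
  refine sum_congr rfl fun d hd => ?_
  have := heq d hd
  simp only [t] at this
  simp only [Equiv.symm_apply_apply]
  split_ifs at this ⊢ <;> omega

open Classical in
/-- The triangle cut off by the corner at `d`. -/
noncomputable def cornerTriangle (M : PlaneEmbedding G F) (d : G.Dart) : Finset V :=
  {d.fst, d.snd, (M.next.symm d).snd}

/-- Two corners with the same triangle would be bounded by the same two edges, hence be equal or
consecutive. -/
theorem cornerTriangle_ne (hdeg : ∀ v w, G.Adj v w → 3 ≤ G.degree v) (hkite : G.HasNoKite)
    {d e : G.Dart} (hd : M.faceDegree (M.faceOf d) = 3) (he : M.faceDegree (M.faceOf e) = 3)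
    (h : d.fst = e.fst) (hne : d ≠ e) : M.cornerTriangle d ≠ M.cornerTriangle e := fun heq => by
  have hmem : d.snd ∈ M.cornerTriangle e := by
    rw [← heq]
    simp [cornerTriangle]
  simp only [cornerTriangle, mem_insert, mem_singleton] at hmem
  obtain hm | hm | hm := hmem
  · exact d.adj.ne' (hm.trans h.symm)
  · exact hne (Dart.ext _ _ (Prod.ext h hm))
  · have hprev : d = M.next.symm e :=
      Dart.ext _ _ (Prod.ext (h.trans (M.next_symm_fst e).symm) hm)
    refine faceDegree_next_ne_three hdeg hkite hd ?_
    rwa [hprev, Equiv.apply_symm_apply]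

/-- What a vertex of degree 6 sends through a triangular corner, to the triangle and to its
vertices. -/
theorem corner_charge (hsum : ∀ v w, G.Adj v w → 9 ≤ G.degree v + G.degree w)
    (hmax : ∀ v, G.degree v ≤ 6) {d : G.Dart} (hd : M.faceDegree (M.faceOf d) = 3)
    (h6 : G.degree d.fst = 6) :
    (M.triangleCharge d + (M.edgeCharge d + M.edgeCharge (M.next.symm d)) ≤ 5 ∧
      G.IsTriangleOfType (M.cornerTriangle d) 6 6 3) ∨
    (M.triangleCharge d + (M.edgeCharge d + M.edgeCharge (M.next.symm d)) ≤ 3 ∧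
      (G.IsTriangleOfType (M.cornerTriangle d) 6 5 4 ∨
        G.IsTriangleOfType (M.cornerTriangle d) 6 6 4)) ∨
    M.triangleCharge d + (M.edgeCharge d + M.edgeCharge (M.next.symm d)) ≤ 2 := by
  have hdeg := three_le_degree hsum hmax
  have hyz := adj_of_faceDegree_eq_three hdeg hd
  have hxz : G.Adj d.fst (M.next.symm d).snd := by
    rw [← M.next_symm_fst d]
    exact (M.next.symm d).adj
  have hs := hsum _ _ hyz
  have hy := hdeg _ _ d.adj.symm
  have hz := hdeg _ _ hxz.symm
  have hy' := hmax d.snd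
  have hz' := hmax (M.next.symm d).snd
  have ht := triangleCharge_le (M := M) d
  rw [if_pos hd] at ht
  have hg := edgeCharge_le (M := M) d
  have hg' := edgeCharge_le (M := M) (M.next.symm d)
  have hn := edgeCharge_of_ne (M := M) (d := d)
  have hn' := edgeCharge_of_ne (M := M) (d := M.next.symm d)
  have hT (a b c : ℕ) (h : ({G.degree d.fst, G.degree d.snd,
      G.degree (M.next.symm d).snd} : Multiset ℕ) = {a, b, c}) :
      G.IsTriangleOfType (M.cornerTriangle d) a b c :=
    isTriangleOfType_triple d.adj hxz hyz h
  rw [h6] at hT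
  by_cases h3 : G.degree d.snd = 3 ∨ G.degree (M.next.symm d).snd = 3
  · refine Or.inl ⟨by omega, hT 6 6 3 ?_⟩
    obtain ⟨h, h'⟩ | ⟨h, h'⟩ :
      (G.degree d.snd = 3 ∧ G.degree (M.next.symm d).snd = 6) ∨
        (G.degree d.snd = 6 ∧ G.degree (M.next.symm d).snd = 3) := by omega
    · rw [h, h']; decide
    · rw [h, h']
  · refine Or.inr ?_
    by_cases h4 : G.degree d.snd = 4 ∨ G.degree (M.next.symm d).snd = 4
    · refine Or.inl ⟨by omega, ?_⟩
      obtain ⟨h, h'⟩ | ⟨h, h'⟩ | ⟨h, h'⟩ | ⟨h, h'⟩ :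
        (G.degree d.snd = 4 ∧ G.degree (M.next.symm d).snd = 5) ∨
        (G.degree d.snd = 5 ∧ G.degree (M.next.symm d).snd = 4) ∨
        (G.degree d.snd = 4 ∧ G.degree (M.next.symm d).snd = 6) ∨
        (G.degree d.snd = 6 ∧ G.degree (M.next.symm d).snd = 4) := by omega
      · exact Or.inl (hT 6 5 4 (by rw [h, h']; decide))
      · exact Or.inl (hT 6 5 4 (by rw [h, h']))
      · exact Or.inr (hT 6 6 4 (by rw [h, h']; decide))
      · exact Or.inr (hT 6 6 4 (by rw [h, h']))
    · refine Or.inr ?_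
      have ht2 : M.triangleCharge d ≤ 2 := by
        rw [triangleCharge, if_pos hd, if_neg (by omega)]
        split_ifs <;> omega
      omega

variable (hsum : ∀ v w, G.Adj v w → 9 ≤ G.degree v + G.degree w) (hmax : ∀ v, G.degree v ≤ 6)
  (hkite : G.HasNoKite)
  (hfour : ∀ a b c d, M.IsFourFace a b c d → G.degree a = 3 → G.degree c ≠ 3)
  (hthree : ∀ v, G.degree v = 6 → ∀ T₁ T₂ T₃ : Finset V,
      T₁ ≠ T₂ → T₁ ≠ T₃ → T₂ ≠ T₃ → v ∈ T₁ → v ∈ T₂ → v ∈ T₃ →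
      G.IsTriangleOfType T₁ 6 6 3 → G.IsTriangleOfType T₂ 6 6 3 →
      ¬ (G.IsTriangleOfType T₃ 6 6 3 ∨ G.IsTriangleOfType T₃ 6 5 4 ∨
        G.IsTriangleOfType T₃ 6 6 4))

include hsum hmax hkite hfour hthree

open Classical in
theorem six_vertex_charge {v : V} (hv : G.degree v = 6) :
    ∑ d : G.Dart with d.fst = v, (M.triangleCharge d + M.edgeCharge d) ≤ 12 := by
  have hdeg := three_le_degree hsum hmax
  have h2 := two_mul_card_triangular_le (M := M) hdeg hkite v
  rw [sum_add_distrib]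
  by_cases ht : #{d : G.Dart | d.fst = v ∧ M.faceDegree (M.faceOf d) = 3} = 3
  · have htri : ∑ d : G.Dart with d.fst = v, M.triangleCharge d =
        ∑ d : G.Dart with d.fst = v ∧ M.faceDegree (M.faceOf d) = 3, M.triangleCharge d := by
      rw [← filter_filter]
      refine (sum_filter_of_ne fun d _ hne => ?_).symm
      by_contra hd
      exact hne (if_neg hd)
    rw [htri, sum_eq_sum_triangular (M := M) hdeg hkite (by rw [ht, hv]) M.edgeCharge,
      ← sum_add_distrib]
    obtain ⟨x, y, z, hxy, hxz, hyz, hS⟩ := card_eq_three.1 ht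
    have hmem (d : G.Dart) (hd : d ∈ ({x, y, z} : Finset G.Dart)) :
        d.fst = v ∧ M.faceDegree (M.faceOf d) = 3 := by
      rw [← hS] at hd
      exact (mem_filter.1 hd).2
    obtain ⟨hx, hx3⟩ := hmem x (by simp)
    obtain ⟨hy, hy3⟩ := hmem y (by simp)
    obtain ⟨hz, hz3⟩ := hmem z (by simp)
    rw [hS, sum_insert (by simp [hxy, hxz]), sum_pair hyz]
    have hvx : v ∈ M.cornerTriangle x := by simp [cornerTriangle, hx]
    have hvy : v ∈ M.cornerTriangle y := by simp [cornerTriangle, hy]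
    have hvz : v ∈ M.cornerTriangle z := by simp [cornerTriangle, hz]
    have hTxy := cornerTriangle_ne hdeg hkite hx3 hy3 (hx.trans hy.symm) hxy
    have hTxz := cornerTriangle_ne hdeg hkite hx3 hz3 (hx.trans hz.symm) hxz
    have hTyz := cornerTriangle_ne hdeg hkite hy3 hz3 (hy.trans hz.symm) hyz
    have h1 := hthree v hv _ _ _ hTxy hTxz hTyz hvx hvy hvz
    have h2 := hthree v hv _ _ _ hTxz hTxy hTyz.symm hvx hvz hvy
    have h3 := hthree v hv _ _ _ hTyz hTxy.symm hTxz.symm hvy hvz hvx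
    -- The admissible worst cases are 5 + 5 + 2 and 5 + 3 + 3; the others above 12 contradict
    -- `hthree`.
    obtain ⟨cx, tx⟩ | ⟨cx, tx⟩ | cx := corner_charge hsum hmax hx3 (by rw [hx, hv]) <;>
    obtain ⟨cy, ty⟩ | ⟨cy, ty⟩ | cy := corner_charge hsum hmax hy3 (by rw [hy, hv]) <;>
    obtain ⟨cz, tz⟩ | ⟨cz, tz⟩ | cz := corner_charge hsum hmax hz3 (by rw [hz, hv]) <;>
    first
      | omega
      | exact absurd (Or.inl tz) (h1 tx ty)
      | exact absurd (Or.inr tz) (h1 tx ty)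
      | exact absurd (Or.inr ty) (h2 tx tz)
      | exact absurd (Or.inr tx) (h3 ty tz)
  -- At most two triangular corners: 2 * 3 for the triangles and 6 along the edges.
  · have h3 := sum_triangleCharge_le (M := M) v
    have h4 := sum_edgeCharge_le (M := M) hsum hmax hfour v
    rw [card_dart_fst, hv] at h4
    omega

open Classical in
theorem vertex_charge {v : V} (hv : 0 < G.degree v) :
    24 + ∑ d : G.Dart with d.fst = v, (M.triangleCharge d + M.edgeCharge d) ≤
      6 * #{d : G.Dart | d.fst = v} +
        ∑ d : G.Dart with d.fst = v, (M.longFaceCharge d + M.edgeCharge d.symm) := by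
  have hdeg := three_le_degree hsum hmax
  obtain ⟨w, hw⟩ := (G.degree_pos_iff_exists_adj v).1 hv
  have h3 := hdeg _ _ hw
  have h6 := hmax v
  have hedge (h : G.degree v ≤ 5) : ∑ d : G.Dart with d.fst = v, M.edgeCharge d = 0 := by
    refine sum_eq_zero fun d hd => edgeCharge_of_ne ?_
    obtain rfl := (mem_filter.1 hd).2
    have := hsum _ _ d.adj
    omega
  obtain h | h | h | h : G.degree v = 3 ∨ G.degree v = 4 ∨ G.degree v = 5 ∨ G.degree v = 6 := by
    omega
  · exact three_vertex_charge hsum h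
  · rw [card_dart_fst, sum_add_distrib, hedge (by omega), sum_eq_zero fun d hd => ?_, h]
    · omega
    · obtain rfl := (mem_filter.1 hd).2
      have h1 := hsum _ _ d.adj
      have h2 := hsum _ _ (M.next.symm d).adj
      rw [M.next_symm_fst] at h2
      rw [triangleCharge]
      split_ifs <;> omega
  -- A 5-vertex has charge 6 and at most two triangular corners, at 3 each.
  · have h1 := two_mul_card_triangular_le (M := M) hdeg hkite v
    have h2 := sum_triangleCharge_le (M := M) v
    rw [card_dart_fst, sum_add_distrib, hedge (by omega)]
    omega
  · have := six_vertex_charge hsum hmax hkite hfour hthree h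
    rw [card_dart_fst]
    omega

theorem two_mul_add_le_card_dart [Fintype F] [Nonempty G.Dart] :
    2 * #{v : V | 0 < G.degree v} + 2 * Fintype.card F ≤ Fintype.card G.Dart := by
  classical
  have hv := sum_le_sum fun v (hv : v ∈ ({v : V | 0 < G.degree v} : Finset V)) =>
    vertex_charge (M := M) hsum hmax hkite hfour hthree (mem_filter.1 hv).2
  have hface (f : F) : 24 + ∑ e : G.Dart with M.faceOf e = f, M.longFaceCharge e ≤
      6 * #{e : G.Dart | M.faceOf e = f} +
        ∑ e : G.Dart with M.faceOf e = f, M.triangleCharge e := by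
    obtain ⟨d, rfl⟩ := M.exists_faceOf_eq (Classical.arbitrary G.Dart) f
    convert face_charge (M := M) hsum hmax d
  have hf := sum_le_sum fun f (_ : f ∈ (univ : Finset F)) => hface f
  have hmaps : ∀ d ∈ (univ : Finset G.Dart), d.fst ∈ ({v : V | 0 < G.degree v} : Finset V) :=
    fun d _ => mem_filter.2 ⟨mem_univ _, (G.degree_pos_iff_exists_adj _).2 ⟨_, d.adj⟩⟩
  -- Reversing darts matches the charge received along edges with the charge sent.
  have hsymm : ∑ d : G.Dart, M.edgeCharge d.symm = ∑ d : G.Dart, M.edgeCharge d :=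
    Equiv.sum_comp (Function.Involutive.toPerm Dart.symm Dart.symm_involutive) M.edgeCharge
  simp only [sum_add_distrib, ← mul_sum, sum_fiberwise_of_maps_to hmaps,
    ← card_eq_sum_card_fiberwise hmaps, hsymm, sum_const, smul_eq_mul] at hv
  simp only [sum_add_distrib, ← mul_sum, sum_const, smul_eq_mul, card_univ,
    sum_fiberwise_of_maps_to (g := M.faceOf) (s := univ) (t := univ) (fun _ _ => mem_univ _),
    ← card_eq_sum_card_fiberwise (f := M.faceOf) (s := univ) (t := univ) (by simp)] at hf
  rw [card_univ] at hv
  omega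

end PlaneEmbedding
end SimpleGraph

end

theorem mainTheorem7 {V : Type u} [Fintype V] (G : SimpleGraph V) [DecidableRel G.Adj]
    {F : Type w} (M : G.PlaneEmbedding F) (hkite : G.HasNoKite) (hΔ : G.maxDegree = 6) :
    (∃ a b : V, G.Adj a b ∧ G.degree a + G.degree b ≤ 8) ∨
    (∃ a b c d : V, M.IsFourFace a b c d ∧ G.degree a = 3 ∧ G.degree c = 3) ∨
    (∃ v : V, G.degree v = 6 ∧ ∃ T₁ T₂ T₃ : Finset V,
      T₁ ≠ T₂ ∧ T₁ ≠ T₃ ∧ T₂ ≠ T₃ ∧ v ∈ T₁ ∧ v ∈ T₂ ∧ v ∈ T₃ ∧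
      G.IsTriangleOfType T₁ 6 6 3 ∧ G.IsTriangleOfType T₂ 6 6 3 ∧
      (G.IsTriangleOfType T₃ 6 6 3 ∨ G.IsTriangleOfType T₃ 6 5 4 ∨
        G.IsTriangleOfType T₃ 6 6 4)) := by
  by_contra! h
  obtain ⟨hsum, hfour, hthree⟩ := h
  have hV : Nonempty V := by
    by_contra hV
    rw [not_nonempty_iff] at hV
    simp at hΔ
  obtain ⟨v, hv⟩ := G.exists_maximal_degree_vertex
  obtain ⟨w, hw⟩ := (G.degree_pos_iff_exists_adj v).1 (by omega)
  have : Nonempty G.Dart := ⟨⟨(v, w), hw⟩⟩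
  -- Finiteness of the face set is not assumed; it follows as every face has a dart on its boundary.
  have : Finite F := Finite.of_surjective M.faceOf (M.exists_faceOf_eq ⟨(v, w), hw⟩)
  have := Fintype.ofFinite F
  have h1 := M.card_dart_lt
  have h2 := SimpleGraph.PlaneEmbedding.two_mul_add_le_card_dart (M := M) hsum
    (fun v => hΔ ▸ G.degree_le_maxDegree v) hkite hfour
    fun v hv T₁ T₂ T₃ h12 h13 h23 hv1 hv2 hv3 ht1 ht2 ht3 => by
      have := hthree v hv T₁ T₂ T₃ h12 h13 h23 hv1 hv2 hv3 ht1 ht2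
      tauto
  omega
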